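/- Let $G$ be a group. Recall that $G$ is \emph{left-orderable} if there is a strict total ordering $<$ of $G$ such that $g<h$ implies $fg<fh$ for all $f,g,h\in G$. Let $LO(G)$ be the space of left-orderings of $G$, that is, the collection of all subsets $P\subset G$ such that $P\cdot P\subset P$, $P\cap P^{-1}=\emptyset$ and $P\cup P^{-1}=G\setminus\{1\}$ (such a $P$ is the positive cone $\{g : 1<g\}$ of a left-ordering of $G$). \textbf{Theorem.} If $G$ is a left-orderable group, then $LO(G)$ is either finite or uncountable. -/

import Mathlib

open scoped Pointwise

/-- `G` is left-orderable: it admits a strict total ordering `r` that is left invariant. -/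
def IsLeftOrderable (G : Type*) [Group G] : Prop :=
  ∃ r : G → G → Prop, IsStrictTotalOrder G r ∧ ∀ f g h : G, r g h → r (f * g) (f * h)

/-- The space of left-orderings `LO(G)`: the collection of all subsets `P` of `G` (positive cones)
that are closed under multiplication, are disjoint from `P⁻¹`, and satisfy `P ∪ P⁻¹ = G \ {1}`. -/
def LO (G : Type*) [Group G] : Set (Set G) :=
  {P | (∀ g ∈ P, ∀ h ∈ P, g * h ∈ P) ∧ P ∩ P⁻¹ = ∅ ∧ P ∪ P⁻¹ = Set.univ \ {1}}

/-!
The space `LO G` is compact, and `G` acts on it by conjugation. Suppose it is nonempty and countable.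
A minimal closed invariant subset has an isolated point by Baire's theorem, hence is finite, so some
order `P` has a finite conjugation orbit and conjugation by `k`-th powers preserves `P` for some
`k ≠ 0` (`exists_isPowInvariant`).

The signs on any set of convex jumps of `P` can be reversed independently, so `P` has only finitely
many convex subgroups (`finite_isConvexFor_of_countable`). Let `C` be the largest proper one.
Invariance under `k`-th powers makes positive elements outside `C` cofinal, so `C` is normal and
`G ⧸ C` is commutative with an archimedean order; two independent elements of `G ⧸ C` would give
a family of orders indexed by the slopes in `ℝ` (`not_countable_LO_of_independent`), so `G ⧸ C` has
rank one.

Finiteness of `LO G` is proved by induction on the number of convex subgroups of `P`, together with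
the fact that all orders have the same convex subgroups (`finite_LO_and_isConvexFor_iff`). The orders
of `C` form a countable space, so the induction hypothesis applies to `C`; let `N` be its largest
proper convex subgroup, which is normal in `G` since it is convex for every order of `C`. If
conjugation by every element of `G` preserved the order of `C ⧸ N`, then `G ⧸ N` would be abelian of
rank two or would act affinely on the real line, with uncountably many orders in either case
(`exists_conj_inv_mem`). Hence some element reverses the order of `C ⧸ N`, and this forces `C` to be
convex for every order of `G` (`isConvexFor_of_conj_inv_mem`). An order of `G` is then determined by
its restriction to `C` and one sign, which leaves finitely many.
-/

/-! ### Positive cones -/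

section Cone

variable {G : Type*} [Group G] {P Q : Set G}

theorem mem_LO_iff : P ∈ LO G ↔ (∀ g ∈ P, ∀ h ∈ P, g * h ∈ P) ∧ (∀ g ∈ P, g⁻¹ ∉ P) ∧
    ∀ g, g ≠ 1 → g ∈ P ∨ g⁻¹ ∈ P := by
  constructor
  · rintro ⟨hm, hd, hu⟩
    refine ⟨hm, fun g hg hg' => ?_, fun g hg => ?_⟩
    · have : g ∈ P ∩ P⁻¹ := ⟨hg, hg'⟩
      simp [hd] at this
    · have : g ∈ P ∪ P⁻¹ := by rw [hu]; simpa using hg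
      exact this
  · rintro ⟨hm, hd, hu⟩
    refine ⟨hm, ?_, ?_⟩
    · ext g
      simpa using hd g
    · ext g
      simp only [Set.mem_union, Set.mem_inv, Set.mem_sdiff, Set.mem_univ, true_and,
        Set.mem_singleton_iff]
      refine ⟨?_, hu g⟩
      rintro h rfl
      rw [inv_one, or_self] at h
      exact hd 1 h (by rwa [inv_one])

namespace LO

protected theorem mul_mem (hP : P ∈ LO G) {g h : G} (hg : g ∈ P) (hh : h ∈ P) : g * h ∈ P :=
  hP.1 g hg h hh

protected theorem inv_notMem (hP : P ∈ LO G) {g : G} (hg : g ∈ P) : g⁻¹ ∉ P :=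
  (mem_LO_iff.1 hP).2.1 g hg

protected theorem one_notMem (hP : P ∈ LO G) : (1 : G) ∉ P := fun h =>
  LO.inv_notMem hP h (by rwa [inv_one])

protected theorem ne_one (hP : P ∈ LO G) {g : G} (hg : g ∈ P) : g ≠ 1 := by
  rintro rfl
  exact LO.one_notMem hP hg

protected theorem mem_or_inv_mem (hP : P ∈ LO G) {g : G} (hg : g ≠ 1) : g ∈ P ∨ g⁻¹ ∈ P :=
  (mem_LO_iff.1 hP).2.2 g hg

protected theorem inv_mem_of_notMem (hP : P ∈ LO G) {g : G} (h1 : g ≠ 1) (hg : g ∉ P) : g⁻¹ ∈ P :=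
  (LO.mem_or_inv_mem hP h1).resolve_left hg

protected theorem pow_succ_mem (hP : P ∈ LO G) {g : G} (hg : g ∈ P) (n : ℕ) : g ^ (n + 1) ∈ P := by
  induction n with
  | zero => simpa using hg
  | succ n ih => rw [pow_succ]; exact LO.mul_mem hP ih hg

protected theorem pow_mem (hP : P ∈ LO G) {g : G} (hg : g ∈ P) {n : ℕ} (hn : n ≠ 0) : g ^ n ∈ P := by
  obtain ⟨m, rfl⟩ := Nat.exists_eq_succ_of_ne_zero hn
  exact LO.pow_succ_mem hP hg m

/-- An order is determined by its positive cone, so inclusion of cones is equality. -/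
protected theorem eq_of_subset (hP : P ∈ LO G) (hQ : Q ∈ LO G) (h : P ⊆ Q) : P = Q := by
  refine Set.Subset.antisymm h fun g hg => by_contra fun hg' => ?_
  exact LO.inv_notMem hQ hg (h (LO.inv_mem_of_notMem hP (LO.ne_one hQ hg) hg'))

protected theorem inv_mem (hP : P ∈ LO G) : P⁻¹ ∈ LO G := by
  refine mem_LO_iff.2 ⟨fun g hg h hh => ?_, fun g hg hg' => ?_, fun g hg => ?_⟩
  · rw [Set.mem_inv, mul_inv_rev]
    exact LO.mul_mem hP hh hg
  · exact LO.inv_notMem hP hg hg'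
  · simpa [or_comm] using LO.mem_or_inv_mem hP hg

protected theorem preimage_mem {H : Type*} [Group H] (hP : P ∈ LO G) {f : H →* G}
    (hf : Function.Injective f) : f ⁻¹' P ∈ LO H := by
  refine mem_LO_iff.2 ⟨fun g hg h hh => ?_, fun g hg => ?_, fun g hg => ?_⟩
  · rw [Set.mem_preimage, map_mul]
    exact LO.mul_mem hP hg hh
  · rw [Set.mem_preimage, map_inv]
    exact LO.inv_notMem hP hg
  · rw [Set.mem_preimage, Set.mem_preimage, map_inv]
    exact LO.mem_or_inv_mem hP (by simpa using hf.ne hg)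

end LO

/-! ### Convex subgroups -/

/-- `C` is convex for the left-ordering with positive cone `P`: if `1 < x < y` and `y ∈ C`, then
`x ∈ C`. -/
def IsConvexFor (P : Set G) (C : Subgroup G) : Prop :=
  ∀ x y, x ∈ P → x⁻¹ * y ∈ P → y ∈ C → x ∈ C

theorem isConvexFor_bot (hP : P ∈ LO G) : IsConvexFor P ⊥ := by
  intro x y hx hxy hy
  rw [Subgroup.mem_bot] at hy
  subst hy
  rw [mul_one] at hxy
  exact absurd hxy (LO.inv_notMem hP hx)

theorem isConvexFor_top : IsConvexFor P ⊤ := fun x _ _ _ _ => Subgroup.mem_top x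

namespace IsConvexFor

variable {C D : Subgroup G}

theorem mul_right_mem (hC : IsConvexFor P C) (hP : P ∈ LO G) {g c : G} (hg : g ∈ P) (hgC : g ∉ C)
    (hc : c ∈ C) : g * c ∈ P := by
  by_contra h
  have h1 : g * c ≠ 1 := fun h1 => hgC (by rw [mul_eq_one_iff_eq_inv.1 h1]; exact inv_mem hc)
  have h2 := LO.inv_mem_of_notMem hP h1 h
  -- `1 < (g * c)⁻¹ < c⁻¹`
  have h3 : (g * c)⁻¹ ∈ C := hC _ c⁻¹ h2 (by simpa using hg) (inv_mem hc)
  exact hgC ((Subgroup.mul_mem_cancel_right C hc).1 (inv_mem_iff.1 h3))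

theorem mul_left_mem (hC : IsConvexFor P C) (hP : P ∈ LO G) {g c : G} (hg : g ∈ P) (hgC : g ∉ C)
    (hc : c ∈ C) : c * g ∈ P := by
  by_contra h
  have h1 : c * g ≠ 1 := fun h1 => hgC (by rw [← inv_eq_iff_mul_eq_one.2 h1]; exact inv_mem hc)
  have h2 := LO.inv_mem_of_notMem hP h1 h
  exact hgC (hC g c⁻¹ hg (by simpa using h2) (inv_mem hc))

theorem of_pow_mem (hC : IsConvexFor P C) (hP : P ∈ LO G) {g : G} {n : ℕ} (hn : n ≠ 0)
    (h : g ^ n ∈ C) : g ∈ C := by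
  have key : ∀ x ∈ P, x ^ n ∈ C → x ∈ C := by
    intro x hx hxn
    obtain ⟨m, rfl⟩ := Nat.exists_eq_succ_of_ne_zero hn
    rcases m with _ | m
    · simpa using hxn
    · refine hC x _ hx ?_ hxn
      rw [Nat.succ_eq_add_one, pow_succ', inv_mul_cancel_left]
      exact LO.pow_succ_mem hP hx m
  by_cases h1 : g = 1
  · rw [h1]; exact one_mem C
  rcases LO.mem_or_inv_mem hP h1 with hg | hg
  · exact key g hg h
  · exact inv_mem_iff.1 (key _ hg (by rw [inv_pow]; exact inv_mem h))

theorem of_zpow_mem (hC : IsConvexFor P C) (hP : P ∈ LO G) {g : G} {m : ℤ} (hm : m ≠ 0)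
    (h : g ^ m ∈ C) : g ∈ C := by
  obtain ⟨n, rfl | rfl⟩ := m.eq_nat_or_neg
  · exact hC.of_pow_mem hP (by simpa using hm) (by simpa using h)
  · exact hC.of_pow_mem hP (n := n) (by simpa using hm) (by simpa using h)

theorem le_total (hC : IsConvexFor P C) (hD : IsConvexFor P D) (hP : P ∈ LO G) :
    C ≤ D ∨ D ≤ C := by
  have pos : ∀ {K : Subgroup G} {x : G}, x ∈ K → ∀ {L : Subgroup G}, x ∉ L →
      ∃ y ∈ K, y ∉ L ∧ y ∈ P := by
    intro K x hx L hxL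
    rcases LO.mem_or_inv_mem hP (g := x) (by rintro rfl; exact hxL (one_mem L)) with h | h
    · exact ⟨x, hx, hxL, h⟩
    · exact ⟨x⁻¹, inv_mem hx, fun h' => hxL (inv_mem_iff.1 h'), h⟩
  by_contra! hne
  obtain ⟨c, hc, hcD⟩ := SetLike.not_le_iff_exists.1 hne.1
  obtain ⟨d, hd, hdC⟩ := SetLike.not_le_iff_exists.1 hne.2
  obtain ⟨x, hxC, hxD, hx⟩ := pos hc hcD
  obtain ⟨y, hyD, hyC, hy⟩ := pos hd hdC
  have h1 : x⁻¹ * y ≠ 1 := fun h => hxD (by rwa [inv_mul_eq_one.1 h])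
  rcases LO.mem_or_inv_mem hP h1 with h | h
  · exact hxD (hD x y hx h hyD)
  · exact hyC (hC y x hy (by simpa using h) hxC)

end IsConvexFor

/-! ### Changing the order on a convex subgroup -/

/-- Keeping the order outside a convex subgroup and replacing it inside is injective in the new
order of the subgroup. -/
theorem countable_LO_of_isConvexFor (hP : P ∈ LO G) {C : Subgroup G} (hC : IsConvexFor P C)
    (hcount : (LO G).Countable) : (LO C).Countable := by
  refine Set.MapsTo.countable_of_injOn
    (f := fun R : Set C => {g : G | (∃ h : g ∈ C, (⟨g, h⟩ : C) ∈ R) ∨ (g ∉ C ∧ g ∈ P)})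
    (t := LO G) ?_ ?_ hcount
  · intro R hR
    refine mem_LO_iff.2 ⟨?_, ?_, ?_⟩
    · rintro g (⟨hg, hg'⟩ | ⟨hg, hg'⟩) h (⟨hh, hh'⟩ | ⟨hh, hh'⟩)
      · exact Or.inl ⟨mul_mem hg hh, LO.mul_mem hR hg' hh'⟩
      · exact Or.inr ⟨fun h' => hh ((Subgroup.mul_mem_cancel_left C hg).1 h'),
          hC.mul_left_mem hP hh' hh hg⟩
      · exact Or.inr ⟨fun h' => hg ((Subgroup.mul_mem_cancel_right C hh).1 h'),
          hC.mul_right_mem hP hg' hg hh⟩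
      · refine Or.inr ⟨fun h' => hg ?_, LO.mul_mem hP hg' hh'⟩
        exact hC g (g * h) hg' (by simpa using hh') h'
    · rintro g (⟨hg, hg'⟩ | ⟨hg, hg'⟩) (⟨hh, hh'⟩ | ⟨hh, hh'⟩)
      · exact LO.inv_notMem hR hg' hh'
      · exact hh (inv_mem hg)
      · exact hg (inv_mem_iff.1 hh)
      · exact LO.inv_notMem hP hg' hh'
    · intro g hg
      by_cases hgC : g ∈ C
      · rcases LO.mem_or_inv_mem hR (g := ⟨g, hgC⟩) (by simpa using hg) with h | h
        · exact Or.inl (Or.inl ⟨hgC, h⟩)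
        · exact Or.inr (Or.inl ⟨inv_mem hgC, h⟩)
      · rcases LO.mem_or_inv_mem hP hg with h | h
        · exact Or.inl (Or.inr ⟨hgC, h⟩)
        · exact Or.inr (Or.inr ⟨fun h' => hgC (inv_mem_iff.1 h'), h⟩)
  · intro R _ S _ hRS
    ext ⟨c, hc⟩
    have := Set.ext_iff.1 hRS c
    simpa [hc] using this

/-- Two elements lie in the same convex jump exactly when their sets of convex subgroups containing
them agree. The signs of all elements of an arbitrary set of jumps can be reversed simultaneously,
so infinitely many convex subgroups give uncountably many orders. -/
theorem finite_isConvexFor_of_countable (hP : P ∈ LO G) (hcount : (LO G).Countable) :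
    {C : Subgroup G | IsConvexFor P C}.Finite := by
  set key : G → Set (Subgroup G) := fun g => {C | IsConvexFor P C ∧ g ∈ C} with hkey
  have key_inv : ∀ g, key g⁻¹ = key g := fun g => by simp [hkey]
  -- An element of a larger jump dominates products with elements of a smaller one.
  have dom : ∀ x y K, IsConvexFor P K → y ∈ K → x ∉ K → key (x * y) = key x ∧ key (y * x) = key x ∧
      (x ∈ P → x * y ∈ P ∧ y * x ∈ P) := by
    intro x y K hK hy hx
    have h1 : ∀ L, IsConvexFor P L → (x * y ∈ L ↔ x ∈ L) ∧ (y * x ∈ L ↔ x ∈ L) := by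
      intro L hL
      by_cases hyL : y ∈ L
      · exact ⟨Subgroup.mul_mem_cancel_right L hyL, Subgroup.mul_mem_cancel_left L hyL⟩
      · have hLK : L ≤ K := (hL.le_total hK hP).resolve_right fun h => hyL (h hy)
        have hxL : x ∉ L := fun h => hx (hLK h)
        exact ⟨iff_of_false (fun h => hx ((Subgroup.mul_mem_cancel_right K hy).1 (hLK h))) hxL,
          iff_of_false (fun h => hx ((Subgroup.mul_mem_cancel_left K hy).1 (hLK h))) hxL⟩
    refine ⟨?_, ?_, fun hxP => ⟨hK.mul_right_mem hP hxP hx hy, hK.mul_left_mem hP hxP hx hy⟩⟩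
    · ext L
      exact and_congr_right fun hL => (h1 L hL).1
    · ext L
      exact and_congr_right fun hL => (h1 L hL).2
  have same : ∀ x y, x ∈ P → y ∈ P → key x = key y → key (x * y) = key x := by
    intro x y hx hy hxy
    ext L
    refine and_congr_right fun hL => ⟨fun h => hL x _ hx (by simpa using hy) h, fun h => ?_⟩
    have : L ∈ key y := hxy ▸ ⟨hL, h⟩
    exact mul_mem h this.2
  set T : Set (Set (Subgroup G)) := key '' {g | g ≠ 1} with hT
  set flip : Set (Set (Subgroup G)) → Set G :=
    fun S => {g | (g ∈ P ∧ key g ∈ S) ∨ (g⁻¹ ∈ P ∧ key g ∉ S)} with hflip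
  have hflipLO : ∀ S, flip S ∈ LO G := by
    intro S
    refine mem_LO_iff.2 ⟨?_, ?_, ?_⟩
    · intro x hx y hy
      by_cases hxy : key x = key y
      · rcases hx with ⟨hx, hxS⟩ | ⟨hx, hxS⟩ <;> rcases hy with ⟨hy, hyS⟩ | ⟨hy, hyS⟩
        · exact Or.inl ⟨LO.mul_mem hP hx hy, by rwa [same x y hx hy hxy]⟩
        · exact absurd (hxy ▸ hxS) hyS
        · exact absurd (hxy ▸ hyS) hxS
        · have h := same _ _ hy hx (by rw [key_inv, key_inv, hxy])
          rw [← mul_inv_rev, key_inv, key_inv] at h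
          exact Or.inr ⟨by rw [mul_inv_rev]; exact LO.mul_mem hP hy hx, by rwa [h]⟩
      · have hlt : (∃ K, IsConvexFor P K ∧ y ∈ K ∧ x ∉ K) ∨
            (∃ K, IsConvexFor P K ∧ x ∈ K ∧ y ∉ K) := by
          by_contra! hne
          exact hxy (Set.ext fun K => and_congr_right fun hK =>
            ⟨fun h => hne.2 K hK h, fun h => hne.1 K hK h⟩)
        rcases hlt with ⟨K, hK, hyK, hxK⟩ | ⟨K, hK, hxK, hyK⟩
        · obtain ⟨h1, -, h2⟩ := dom x y K hK hyK hxK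
          obtain ⟨-, -, h3⟩ := dom x⁻¹ y⁻¹ K hK (inv_mem hyK) (fun h => hxK (inv_mem_iff.1 h))
          rcases hx with ⟨hx, hxS⟩ | ⟨hx, hxS⟩
          · exact Or.inl ⟨(h2 hx).1, by rwa [h1]⟩
          · exact Or.inr ⟨by rw [mul_inv_rev]; exact (h3 hx).2, by rwa [h1]⟩
        · obtain ⟨-, h1, h2⟩ := dom y x K hK hxK hyK
          obtain ⟨-, -, h3⟩ := dom y⁻¹ x⁻¹ K hK (inv_mem hxK) (fun h => hyK (inv_mem_iff.1 h))
          rcases hy with ⟨hy, hyS⟩ | ⟨hy, hyS⟩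
          · exact Or.inl ⟨(h2 hy).2, by rwa [h1]⟩
          · exact Or.inr ⟨by rw [mul_inv_rev]; exact (h3 hy).1, by rwa [h1]⟩
    · rintro x (⟨hx, hxS⟩ | ⟨hx, hxS⟩) (⟨hx', hxS'⟩ | ⟨hx', hxS'⟩)
      · exact LO.inv_notMem hP hx hx'
      · exact hxS' (by rwa [key_inv])
      · exact hxS (by rwa [key_inv] at hxS')
      · exact LO.inv_notMem hP hx hx'
    · intro x hx
      simp only [hflip, Set.mem_ofPred_eq, key_inv, inv_inv]
      have := LO.mem_or_inv_mem hP hx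
      tauto
  have hinj : Set.InjOn flip (𝒫 T) := by
    have aux : ∀ S ∈ 𝒫 T, ∀ S', flip S = flip S' → S ⊆ S' := by
      intro S hS S' h s hs
      obtain ⟨g, hg, rfl⟩ := hS hs
      obtain ⟨x, hx, hxg⟩ : ∃ x ∈ P, key x = key g := by
        rcases LO.mem_or_inv_mem hP hg with h | h
        exacts [⟨g, h, rfl⟩, ⟨g⁻¹, h, key_inv g⟩]
      have hxS : x ∈ flip S := Or.inl ⟨hx, by rwa [hxg]⟩
      rw [h] at hxS
      rcases hxS with h | h
      · rw [← hxg]; exact h.2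
      · exact absurd h.1 (LO.inv_notMem hP hx)
    intro S hS S' hS' h
    exact Set.Subset.antisymm (aux S hS S' h) (aux S' hS' S h.symm)
  have hcT : (𝒫 T).Countable :=
    Set.MapsTo.countable_of_injOn (fun S _ => hflipLO S) hinj hcount
  have hTfin : T.Finite := by
    by_contra hTinf
    have : Infinite T := Set.infinite_coe_iff.2 hTinf
    have h2 : Countable (Set T) := by
      have : Countable (𝒫 T) := hcT.to_subtype
      exact (Equiv.Set.powerset T).symm.injective.countable
    obtain ⟨f, hf⟩ := exists_injective_nat (Set T)
    exact Function.cantor_injective _ ((Infinite.natEmbedding T).injective.comp hf)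
  -- A convex subgroup is recovered from the set of jumps which it contains.
  refine Set.Finite.of_injOn (f := fun C => {k ∈ T | C ∈ k}) (t := 𝒫 T) (fun C _ k hk => hk.1) ?_
    hTfin.finite_subsets
  have aux : ∀ C, IsConvexFor P C → ∀ D, {k ∈ T | C ∈ k} = {k ∈ T | D ∈ k} → C ≤ D := by
    intro C hC D h g hg
    by_cases h1 : g = 1
    · rw [h1]; exact one_mem D
    · have : key g ∈ {k ∈ T | C ∈ k} := ⟨⟨g, h1, rfl⟩, hC, hg⟩
      rw [h] at this
      exact this.2.2
  intro C hC D hD h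
  exact le_antisymm (aux C hC D h) (aux D hD C h.symm)

end Cone

/-! ### Finite orbits in countable compact spaces -/

/-- A minimal nonempty closed invariant subset of a countable compact Hausdorff space has an
isolated point by Baire's theorem. By minimality it is then a single orbit consisting of isolated
points, hence finite by compactness. -/
theorem exists_finite_orbit_of_countable (Γ X : Type*) [Group Γ] [TopologicalSpace X]
    [CompactSpace X] [T2Space X] [MulAction Γ X] [ContinuousConstSMul Γ X] [Countable X]
    [Nonempty X] : ∃ x : X, (MulAction.orbit Γ x).Finite := by
  obtain ⟨M, -, ⟨hMne, hMcl, hMinv⟩, hmin⟩ := zorn_superset_nonempty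
    {M : Set X | M.Nonempty ∧ IsClosed M ∧ ∀ g : Γ, ∀ x ∈ M, g • x ∈ M} (by
      intro c hc hchain hcne
      have : Nonempty c := hcne.to_subtype
      refine ⟨⋂₀ c, ⟨?_, isClosed_sInter fun s hs => (hc hs).2.1, ?_⟩,
        fun s hs => Set.sInter_subset_of_mem hs⟩
      · exact IsCompact.nonempty_sInter_of_directed_nonempty_isCompact_isClosed
          (fun a ha b hb => (hchain.total ha hb).elim
            (fun h => ⟨a, ha, subset_rfl, h⟩) fun h => ⟨b, hb, h, subset_rfl⟩)
          (fun s hs => (hc hs).1) (fun s hs => (hc hs).2.1.isCompact)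
          (fun s hs => (hc hs).2.1)
      · intro g x hx s hs
        exact (hc hs).2.2 g x (hx s hs))
    Set.univ ⟨Set.univ_nonempty, isClosed_univ, fun _ _ _ => Set.mem_univ _⟩
  have : CompactSpace M := isCompact_iff_compactSpace.1 hMcl.isCompact
  have : Nonempty M := hMne.to_subtype
  obtain ⟨p, hp⟩ := nonempty_interior_of_iUnion_of_closed (f := fun p : M => ({p} : Set M))
    (fun p => isClosed_singleton) (by ext p; simp)
  have hpo : IsOpen ({p} : Set M) := by
    have : interior ({p} : Set M) = {p} :=
      (Set.subset_singleton_iff_eq.1 interior_subset).resolve_left hp.ne_empty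
    rw [← this]; exact isOpen_interior
  obtain ⟨U, hU, hUp⟩ := isOpen_induced_iff.1 hpo
  have hUM : ∀ x ∈ M, x ∈ U → x = p := fun x hx hxU => by
    have : (⟨x, hx⟩ : M) ∈ ((↑) : M → X) ⁻¹' U := hxU
    rw [hUp] at this
    exact congrArg Subtype.val this
  have hpU : (p : X) ∈ U := by
    have : p ∈ ((↑) : M → X) ⁻¹' U := by rw [hUp]; rfl
    exact this
  have horb : ∀ x ∈ M, ∃ g : Γ, g • x ∈ U := by
    intro x hx
    have hsub : closure (MulAction.orbit Γ x) ⊆ M :=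
      closure_minimal (by rintro _ ⟨g, rfl⟩; exact hMinv g x hx) hMcl
    have hMsub : M ⊆ closure (MulAction.orbit Γ x) := by
      refine hmin ⟨(MulAction.nonempty_orbit x).closure, isClosed_closure, fun g y hy => ?_⟩ hsub
      exact smul_closure_orbit_subset g x (Set.smul_mem_smul_set hy)
    obtain ⟨_, hyU, ⟨g, rfl⟩⟩ := mem_closure_iff.1 (hMsub p.2) U hU hpU
    exact ⟨g, hyU⟩
  obtain ⟨I, hI⟩ := hMcl.isCompact.elim_finite_subcover (fun g : Γ => (g • · : X → X) ⁻¹' U)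
    (fun g => hU.preimage (continuous_const_smul g))
    (fun x hx => Set.mem_iUnion.2 (horb x hx))
  refine ⟨p, (I.finite_toSet.image fun g => g⁻¹ • (p : X)).subset ?_⟩
  rintro _ ⟨h, rfl⟩
  have hm := hMinv h p p.2
  obtain ⟨g, hg, hgU⟩ : ∃ g ∈ I, g • h • (p : X) ∈ U := by simpa using hI hm
  exact ⟨g, hg, inv_smul_eq_iff.2 (hUM _ (hMinv g _ hm) hgU).symm⟩

section Conj

variable {G : Type*} [Group G] {P : Set G}

/-- The cone `P` is invariant under conjugation by all `k`-th powers. For `k ≠ 0` this is a form of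
having a finite orbit under conjugation which passes to subgroups. -/
def IsPowInvariant (k : ℕ) (P : Set G) : Prop :=
  ∀ g x : G, x ∈ P → g ^ k * x * (g ^ k)⁻¹ ∈ P

/-- The space of orders is compact, so if it is countable then some order has a finite orbit under
conjugation; the stabilizer of that order has finite index. -/
theorem exists_isPowInvariant (hne : (LO G).Nonempty) (hcount : (LO G).Countable) :
    ∃ P ∈ LO G, ∃ k ≠ 0, IsPowInvariant k P := by
  -- Cones are encoded as Boolean functions, since `Prop` does not carry the discrete topology.
  set X := {p : G → Bool // {g | p g = true} ∈ LO G} with hX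
  have hclosed : IsClosed {p : G → Bool | {g | p g = true} ∈ LO G} := by
    have : {p : G → Bool | {g | p g = true} ∈ LO G} =
        (⋂ g, ⋂ h, {p | p g = true → p h = true → p (g * h) = true}) ∩
        ((⋂ g, {p | p g = true → ¬ p g⁻¹ = true}) ∩
        ⋂ g, {p | g ≠ 1 → p g = true ∨ p g⁻¹ = true}) := by
      ext p
      simp only [mem_LO_iff, Set.mem_ofPred_eq, Set.mem_inter_iff, Set.mem_iInter]
      refine and_congr_left fun _ => ⟨fun h g g' a b => h g a g' b, fun h g a g' b => h g g' a b⟩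
    rw [this]
    have hcl : ∀ (s : Set G) (hs : s.Finite) (S : Set (G → Bool)),
        (∀ p q : G → Bool, (∀ g ∈ s, p g = q g) → p ∈ S → q ∈ S) → IsClosed S := by
      intro s hs S hS
      rw [← isOpen_compl_iff, isOpen_pi_iff]
      intro p hp
      refine ⟨hs.toFinset, fun g => {p g}, fun g _ => ⟨isOpen_discrete _, rfl⟩, fun q hq hqS => ?_⟩
      exact hp (hS q p (fun g hg => hq g (by simpa using hg)) hqS)
    refine IsClosed.inter (isClosed_iInter fun g => isClosed_iInter fun h => ?_)
      (IsClosed.inter (isClosed_iInter fun g => ?_) (isClosed_iInter fun g => ?_))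
    · refine hcl {g, h, g * h} (by simp) _ fun p q hpq => ?_
      simp only [Set.mem_insert_iff, Set.mem_singleton_iff, forall_eq_or_imp, forall_eq] at hpq
      simp [hpq]
    · refine hcl {g, g⁻¹} (by simp) _ fun p q hpq => ?_
      simp only [Set.mem_insert_iff, Set.mem_singleton_iff, forall_eq_or_imp, forall_eq] at hpq
      simp [hpq]
    · refine hcl {g, g⁻¹} (by simp) _ fun p q hpq => ?_
      simp only [Set.mem_insert_iff, Set.mem_singleton_iff, forall_eq_or_imp, forall_eq] at hpq
      simp [hpq]
  have : CompactSpace X := isCompact_iff_compactSpace.1 hclosed.isCompact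
  have : Countable X := by
    have : Countable (LO G) := hcount.to_subtype
    refine Function.Injective.countable (f := fun p : X => (⟨{g | p.1 g = true}, p.2⟩ : LO G)) ?_
    intro p q hpq
    ext g
    have := Set.ext_iff.1 (congrArg Subtype.val hpq) g
    exact Bool.eq_iff_iff.2 this
  have : Nonempty X := by
    classical
    obtain ⟨P, hP⟩ := hne
    exact ⟨fun g => decide (g ∈ P), by simpa using hP⟩
  let _ : MulAction G X :=
    { smul := fun g p => ⟨fun x => p.1 (g⁻¹ * x * g), by
        have := LO.preimage_mem p.2 (f := (MulAut.conj g⁻¹).toMonoidHom)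
          (MulAut.conj g⁻¹).injective
        simpa [Set.preimage] using this⟩
      one_smul := fun p => Subtype.ext (funext fun x => by
        change p.1 (1⁻¹ * x * 1) = p.1 x
        simp)
      mul_smul := fun g h p => Subtype.ext (funext fun x => by
        change p.1 ((g * h)⁻¹ * x * (g * h)) = p.1 (h⁻¹ * (g⁻¹ * x * g) * h)
        simp [mul_assoc]) }
  have hsmul : ∀ (g : G) (p : X) (x : G), (g • p).1 x = p.1 (g⁻¹ * x * g) := fun _ _ _ => rfl
  have : ContinuousConstSMul G X := ⟨fun g => by
    refine Continuous.subtype_mk (f := fun p : X => fun x => p.1 (g⁻¹ * x * g)) ?_ _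
    exact continuous_pi fun x => (continuous_apply _).comp continuous_subtype_val⟩
  obtain ⟨p, hp⟩ := exists_finite_orbit_of_countable G X
  have hidx : (MulAction.stabilizer G p).index ≠ 0 := by
    rw [MulAction.index_stabilizer]
    exact ((Set.ncard_pos hp).2 (MulAction.nonempty_orbit p)).ne'
  refine ⟨{g | p.1 g = true}, p.2, (MulAction.stabilizer G p).index.factorial,
    Nat.factorial_ne_zero _, fun g x hx => ?_⟩
  have hg := Subgroup.pow_mem_of_index_ne_zero_of_dvd hidx g
    (n := (MulAction.stabilizer G p).index.factorial) fun m hm hm' => Nat.dvd_factorial hm hm'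
  rw [MulAction.mem_stabilizer_iff] at hg
  change p.1 _ = true
  have h2 := hsmul (g ^ (MulAction.stabilizer G p).index.factorial) p
    (g ^ (MulAction.stabilizer G p).index.factorial * x *
      (g ^ (MulAction.stabilizer G p).index.factorial)⁻¹)
  rw [hg] at h2
  rw [h2]
  simpa [mul_assoc] using hx

end Conj

/-! ### Archimedean orders -/

/-- The commutator of two elements is smaller than the square of any positive element `f`, by
comparing both elements with powers of `f`. In a group without a least positive element this forces
commutators to be trivial, and otherwise the group is cyclic. -/
theorem mul_comm_of_forall_exists_lt_pow {E : Type*} [Group E] [LinearOrder E] [MulLeftStrictMono E]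
    [MulRightStrictMono E] (harch : ∀ f : E, 1 < f → ∀ x, ∃ n : ℕ, x < f ^ n) (x y : E) :
    x * y = y * x := by
  have := mulLeftMono_of_mulLeftStrictMono E
  have := mulRightMono_of_mulRightStrictMono E
  have near : ∀ f : E, 1 < f → ∀ a, ∃ m : ℤ, f ^ m ≤ a ∧ a < f ^ (m + 1) := by
    intro f hf a
    obtain ⟨n, hn⟩ := harch f hf a
    obtain ⟨n', hn'⟩ := harch f hf a⁻¹
    have hmono : StrictMono fun m : ℤ => f ^ m := strictMono_int_of_lt_succ fun n => by
      rw [zpow_add_one]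
      exact lt_mul_of_one_lt_right' _ hf
    obtain ⟨m, hm, hmax⟩ := Int.exists_greatest_of_bdd (P := fun m : ℤ => f ^ m ≤ a)
      ⟨n, fun z hz => (hmono.lt_iff_lt.1 (lt_of_le_of_lt hz (by simpa using hn))).le⟩
      ⟨-n', by
        rw [zpow_neg, zpow_natCast]
        exact inv_le_of_inv_le' hn'.le⟩
    refine ⟨m, hm, lt_of_not_ge fun h => ?_⟩
    have := hmax _ h
    lia
  have main : ∀ a b : E, ¬ 1 < a * b * a⁻¹ * b⁻¹ := by
    intro a b he
    set e := a * b * a⁻¹ * b⁻¹ with hedef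
    by_cases hsq : ∃ f : E, 1 < f ∧ f * f ≤ e
    · obtain ⟨f, hf, hfe⟩ := hsq
      obtain ⟨m, hm, hm'⟩ := near f hf a
      obtain ⟨n, hn, hn'⟩ := near f hf b
      have : e < f ^ (m + 1) * f ^ (n + 1) * (f ^ m)⁻¹ * (f ^ n)⁻¹ :=
        mul_lt_mul_of_lt_of_le (mul_lt_mul_of_lt_of_le (mul_lt_mul_of_lt_of_lt hm' hn')
          (inv_le_inv_iff.2 hm)) (inv_le_inv_iff.2 hn)
      have h2 : f ^ (m + 1) * f ^ (n + 1) * (f ^ m)⁻¹ * (f ^ n)⁻¹ = f * f := by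
        rw [← zpow_neg, ← zpow_neg, ← zpow_add, ← zpow_add, ← zpow_add, ← pow_two, ← zpow_natCast]
        congr 1
        push_cast
        ring
      exact absurd (this.trans_eq h2) (not_lt.2 hfe)
    · push Not at hsq
      -- now `e` is the least positive element
      have hmin : ∀ f : E, 1 < f → e ≤ f := by
        intro f hf
        by_contra! hfe
        have h1 : 1 < f⁻¹ * e := lt_inv_mul_iff_lt.2 hfe
        rcases le_total f (f⁻¹ * e) with h | h
        · refine absurd (hsq f hf) (not_lt.2 ?_)
          calc f * f ≤ f * (f⁻¹ * e) := mul_le_mul_right h f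
            _ = e := mul_inv_cancel_left f e
        · refine absurd (hsq _ h1) (not_lt.2 ?_)
          calc f⁻¹ * e * (f⁻¹ * e) ≤ f * (f⁻¹ * e) := mul_le_mul_left h _
            _ = e := mul_inv_cancel_left f e
      have hpow : ∀ c, ∃ m : ℤ, e ^ m = c := by
        intro c
        obtain ⟨m, hm, hm'⟩ := near e he c
        refine ⟨m, hm.eq_or_lt.resolve_right fun h => ?_⟩
        have h1 := hmin _ (lt_inv_mul_iff_lt.2 h)
        rw [zpow_add_one] at hm'
        exact absurd (inv_mul_lt_iff_lt_mul.2 hm') (not_lt.2 h1)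
      obtain ⟨m, hm⟩ := hpow a
      obtain ⟨n, hn⟩ := hpow b
      have hab : a * b = b * a := by
        rw [← hm, ← hn]
        exact Commute.zpow_zpow_self e m n
      have : e = 1 := by
        rw [hedef, hab]
        simp
      exact absurd this he.ne'
  have h1 := main x y
  have h2 := main y x
  have h3 : x * y * x⁻¹ * y⁻¹ = 1 := by
    refine le_antisymm (not_lt.1 h1) (not_lt.1 fun h => h2 ?_)
    have := one_lt_inv'.2 h
    simpa [mul_assoc] using this
  rw [mul_assoc, ← mul_inv_rev, mul_inv_eq_one] at h3
  exact h3

section Archimedean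

variable {E : Type*} [Group E] {P : Set E}

/-- A group with an archimedean left-ordering is commutative. -/
theorem mul_comm_of_archimedean (hP : P ∈ LO E)
    (harch : ∀ f ∈ P, ∀ x, ∃ n : ℕ, x⁻¹ * f ^ n ∈ P) (x y : E) : x * y = y * x := by
  classical
  -- An archimedean left-ordering is invariant under conjugation.
  have hconj : ∀ g, ∀ f ∈ P, g * f * g⁻¹ ∈ P := by
    intro g f hf
    by_contra hneg
    have h1 : g * f * g⁻¹ ≠ 1 := by simpa using LO.ne_one hP hf
    have h2 := LO.inv_mem_of_notMem hP h1 hneg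
    by_cases hg1 : g = 1
    · subst hg1; simp [hf] at hneg
    have hpow : ∀ n : ℕ, (g * f ^ n * g⁻¹)⁻¹ ∈ P ∨ n = 0 := by
      intro n
      by_cases hn : n = 0
      · exact Or.inr hn
      · left
        have := LO.pow_mem hP h2 hn
        rwa [inv_pow, conj_pow] at this
    rcases LO.mem_or_inv_mem hP hg1 with hg | hg
    · -- `1 < g` lies below a power of the positive element `(g * f * g⁻¹)⁻¹`
      obtain ⟨n, hn⟩ := harch _ h2 g
      rw [inv_pow, conj_pow] at hn
      have h3 : (f ^ n)⁻¹ ∈ P := by simpa [mul_assoc] using LO.mul_mem hP hn hg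
      by_cases hn0 : n = 0
      · subst hn0
        exact LO.one_notMem hP (by simpa using h3)
      · exact LO.inv_notMem hP (LO.pow_mem hP hf hn0) h3
    · obtain ⟨n, hn⟩ := harch f hf g⁻¹
      have hn' := LO.mul_mem hP hn hg
      rcases hpow n with h | h
      · refine LO.inv_notMem hP h ?_
        rw [inv_inv]
        simpa [mul_assoc] using hn'
      · subst h
        simp at hn'
        exact LO.inv_notMem hP hn (by simpa using hg)
  let _ : LinearOrder E :=
    { le := fun a b => a = b ∨ a⁻¹ * b ∈ P
      le_refl := fun a => Or.inl rfl
      le_trans := by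
        rintro a b c (rfl | hab) (rfl | hbc)
        · exact Or.inl rfl
        · exact Or.inr hbc
        · exact Or.inr hab
        · exact Or.inr (by simpa [mul_assoc] using LO.mul_mem hP hab hbc)
      le_antisymm := by
        rintro a b (rfl | hab) (hba | hba)
        · rfl
        · rfl
        · exact hba.symm
        · exact absurd (LO.mul_mem hP hab hba) (by simpa [mul_assoc] using LO.one_notMem hP)
      le_total := by
        intro a b
        by_cases hab : a = b
        · exact Or.inl (Or.inl hab)
        · rcases LO.mem_or_inv_mem hP (g := a⁻¹ * b) (by simpa [inv_mul_eq_one] using hab) with h | h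
          · exact Or.inl (Or.inr h)
          · exact Or.inr (Or.inr (by simpa using h))
      toDecidableLE := Classical.decRel _ }
  have hlt : ∀ a b : E, a < b ↔ a⁻¹ * b ∈ P := by
    intro a b
    rw [lt_iff_le_and_ne]
    constructor
    · rintro ⟨h | h, hne⟩
      · exact absurd h hne
      · exact h
    · intro h
      refine ⟨Or.inr h, ?_⟩
      rintro rfl
      exact LO.one_notMem hP (by simpa using h)
  have : MulLeftStrictMono E := ⟨fun a b c h => by
    rw [hlt] at h ⊢
    simpa [mul_assoc] using h⟩
  have : MulRightStrictMono E := ⟨fun a b c h => by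
    rw [hlt] at h
    change b * a < c * a
    rw [hlt]
    simpa [mul_assoc] using hconj a⁻¹ _ h⟩
  refine mul_comm_of_forall_exists_lt_pow (fun f hf x => ?_) x y
  obtain ⟨n, hn⟩ := harch f (by simpa [hlt] using hf) x
  exact ⟨n, (hlt _ _).2 hn⟩

end Archimedean

/-! ### The largest proper convex subgroup -/

section MaxConvex

variable {G : Type*} [Group G] {P : Set G} {C : Subgroup G}

/-- `C` is the largest proper subgroup which is convex for `P`. -/
structure IsMaxConvex (P : Set G) (C : Subgroup G) : Prop where
  convex : IsConvexFor P C
  ne_top : C ≠ ⊤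
  le_of_ne_top : ∀ D, IsConvexFor P D → D ≠ ⊤ → D ≤ C

theorem exists_isMaxConvex [Nontrivial G] (hP : P ∈ LO G)
    (hfin : {C : Subgroup G | IsConvexFor P C}.Finite) : ∃ C, IsMaxConvex P C := by
  obtain ⟨C, ⟨hC, hCtop⟩, hmax⟩ :=
    (hfin.subset (t := {C | IsConvexFor P C ∧ C ≠ ⊤}) fun C h => h.1).exists_maximal
      ⟨⊥, isConvexFor_bot hP, bot_ne_top⟩
  refine ⟨C, hC, hCtop, fun D hD hDtop => ?_⟩
  rcases hD.le_total hC hP with h | h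
  exacts [h, hmax ⟨hD, hDtop⟩ h]

namespace IsMaxConvex

/-- Every positive element outside the largest proper convex subgroup is cofinal. For a `k`-th power
`h` conjugation by `h` preserves the order, so the elements between two powers of `h` form a convex
subgroup, which can only be the whole group. -/
theorem exists_inv_mul_pow_mem (hC : IsMaxConvex P C) (hP : P ∈ LO G) {k : ℕ} (hk : k ≠ 0)
    (hinv : IsPowInvariant k P) {g : G} (hg : g ∈ P) (hgC : g ∉ C) (x : G) :
    ∃ n : ℕ, x⁻¹ * g ^ n ∈ P := by
  set h := g ^ k with hh
  have hhP : h ∈ P := LO.pow_mem hP hg hk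
  have conj : ∀ (n : ℕ) (y : G), y ∈ P → (h ^ n)⁻¹ * y * h ^ n ∈ P := by
    intro n y hy
    have := hinv (g⁻¹ ^ n) y hy
    rwa [← pow_mul, mul_comm, pow_mul, inv_pow, ← hh, inv_pow, inv_inv] at this
  -- the elements `x` with `h⁻ⁿ < x < hⁿ` for some `n`
  let D : Subgroup G :=
    { carrier := {x | ∃ n : ℕ, x⁻¹ * h ^ n ∈ P ∧ x * h ^ n ∈ P}
      one_mem' := ⟨1, by simpa using hhP, by simpa using hhP⟩
      inv_mem' := by
        rintro x ⟨n, h1, h2⟩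
        exact ⟨n, by simpa using h2, h1⟩
      mul_mem' := by
        rintro x y ⟨n, hx, hx'⟩ ⟨m, hy, hy'⟩
        refine ⟨n + m, ?_, ?_⟩
        · have := LO.mul_mem hP hy (conj m _ hx)
          rw [pow_add]
          simpa [mul_assoc] using this
        · have := LO.mul_mem hP hx' (conj n _ hy')
          rw [add_comm, pow_add]
          simpa [mul_assoc] using this }
  have hD : IsConvexFor P D := by
    rintro x y hx hxy ⟨n, hy, -⟩
    by_cases hn : n = 0
    · subst hn
      rw [pow_zero, mul_one] at hy
      exact absurd (by simpa using LO.mul_mem hP hxy hy) (LO.inv_notMem hP hx)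
    · exact ⟨n, by simpa [mul_assoc] using LO.mul_mem hP hxy hy,
        LO.mul_mem hP hx (LO.pow_mem hP hhP hn)⟩
  have hhD : h ∈ D := ⟨2, by simpa [pow_two] using hhP,
    LO.mul_mem hP hhP (LO.pow_mem hP hhP two_ne_zero)⟩
  have htop : D = ⊤ := by
    by_contra hne
    exact hgC (hC.convex.of_pow_mem hP hk (hC.le_of_ne_top D hD hne hhD))
  obtain ⟨n, hn, -⟩ : x ∈ D := htop ▸ Subgroup.mem_top x
  exact ⟨k * n, by rwa [pow_mul]⟩

/-- If a conjugate `g * c * g⁻¹` with `c ∈ C` were outside `C`, its powers would be cofinal, while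
cofinality fails for the powers of `c`. -/
theorem normal (hC : IsMaxConvex P C) (hP : P ∈ LO G) {k : ℕ} (hk : k ≠ 0)
    (hinv : IsPowInvariant k P) : C.Normal := by
  refine ⟨fun c hc g => ?_⟩
  have key : ∀ c ∈ C, g * c * g⁻¹ ∉ C → g * c * g⁻¹ ∉ P := by
    intro c hc hdC hd
    have hgC : g ∉ C := fun h => hdC (mul_mem (mul_mem h hc) (inv_mem h))
    rcases LO.mem_or_inv_mem hP (g := g) (by rintro rfl; exact hgC (one_mem C)) with hg | hg
    · obtain ⟨n, hn⟩ := hC.exists_inv_mul_pow_mem hP hk hinv hd hdC g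
      rw [conj_pow, mul_assoc, inv_mul_cancel_left] at hn
      have h1 := hC.convex.mul_right_mem hP hg hgC (inv_mem (pow_mem hc n))
      exact LO.inv_notMem hP hn (by simpa using h1)
    · obtain ⟨u, rfl⟩ : ∃ u, g = u⁻¹ := ⟨g⁻¹, (inv_inv g).symm⟩
      rw [inv_inv] at hg hd hdC
      have huC : u ∉ C := fun h => hgC (inv_mem h)
      obtain ⟨j, rfl⟩ := Nat.exists_eq_succ_of_ne_zero hk
      set v := u ^ (j + 1) with hv
      obtain ⟨n, hn⟩ := hC.exists_inv_mul_pow_mem hP hk hinv hd hdC (v * v)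
      have hcomm : u * (v * v)⁻¹ = (v * v)⁻¹ * u := by
        have : Commute u v := Commute.self_pow u (j + 1)
        exact ((this.mul_right this).inv_right).eq
      -- multiplying by powers of `u` on both sides turns the inequality into one between
      -- `v ^ 2` and `c ^ n * v`, where conjugation by `v` is monotone
      have h1 : (v * v)⁻¹ * c ^ n * v ∈ P := by
        have h2 : (v * v)⁻¹ * c ^ n * u ∈ P := by
          have h3 := LO.mul_mem hP hg hn
          have h4 : (u⁻¹ * c * u) ^ n = u⁻¹ * c ^ n * u := by
            simpa using conj_pow (i := n) (a := u⁻¹) (b := c)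
          rw [h4, ← mul_assoc, hcomm] at h3
          simpa [mul_assoc] using h3
        by_cases hj : j = 0
        · subst hj
          rw [zero_add, pow_one] at hv
          rw [hv] at h2 ⊢
          exact h2
        · have := LO.mul_mem hP h2 (LO.pow_mem hP hg hj)
          rw [hv, pow_succ' u j]
          rw [hv, pow_succ' u j] at this
          simpa [mul_assoc] using this
      have h5 := hinv u _ h1
      rw [Nat.succ_eq_add_one, ← hv] at h5
      have h6 : v⁻¹ * c ^ n ∈ P := by simpa [mul_assoc] using h5
      have hvC : v ∉ C := fun h => huC (hC.convex.of_pow_mem hP hk h)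
      have h7 := hC.convex.mul_left_mem hP (LO.pow_mem hP hg hk) hvC (inv_mem (pow_mem hc n))
      exact LO.inv_notMem hP h6 (by simpa using h7)
  by_contra hgc
  have h1 : g * c * g⁻¹ ≠ 1 := fun h => hgc (h ▸ one_mem C)
  rcases LO.mem_or_inv_mem hP h1 with h | h
  · exact key c hc hgc h
  · have e : (g * c * g⁻¹)⁻¹ = g * c⁻¹ * g⁻¹ := by group
    refine key c⁻¹ (inv_mem hc) (fun h' => hgc ?_) (e ▸ h)
    rw [← e] at h'
    exact inv_mem_iff.1 h'

/-- The order induced on `G ⧸ C` is archimedean, so `G ⧸ C` is commutative. -/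
theorem commutator_mem (hC : IsMaxConvex P C) (hP : P ∈ LO G) {k : ℕ} (hk : k ≠ 0)
    (hinv : IsPowInvariant k P) (x y : G) : x * y * x⁻¹ * y⁻¹ ∈ C := by
  have hn : C.Normal := hC.normal hP hk hinv
  set R : Set (G ⧸ C) := {e | ∃ g ∈ P, g ∉ C ∧ (g : G ⧸ C) = e} with hR
  have hmem : ∀ g : G, (g : G ⧸ C) ∈ R ↔ g ∈ P ∧ g ∉ C := by
    intro g
    refine ⟨?_, fun h => ⟨g, h.1, h.2, rfl⟩⟩
    rintro ⟨h, hh, hhC, he⟩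
    have h1 : h⁻¹ * g ∈ C := QuotientGroup.eq.1 he
    have h2 := hC.convex.mul_right_mem hP hh hhC h1
    rw [mul_inv_cancel_left] at h2
    refine ⟨h2, fun hg => hhC ?_⟩
    exact inv_mem_iff.1 ((Subgroup.mul_mem_cancel_right C hg).1 h1)
  have hRLO : R ∈ LO (G ⧸ C) := by
    refine mem_LO_iff.2 ⟨fun a ha b hb => ?_, fun a ha => ?_, fun a ha => ?_⟩
    · induction a using QuotientGroup.induction_on with | _ a
      induction b using QuotientGroup.induction_on with | _ b
      rw [hmem] at ha hb
      rw [← QuotientGroup.mk_mul, hmem]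
      exact ⟨LO.mul_mem hP ha.1 hb.1,
        fun h => ha.2 (hC.convex a (a * b) ha.1 (by simpa using hb.1) h)⟩
    · induction a using QuotientGroup.induction_on with | _ a
      rw [hmem] at ha
      rw [← QuotientGroup.mk_inv, hmem]
      exact fun h => LO.inv_notMem hP ha.1 h.1
    · induction a using QuotientGroup.induction_on with | _ a
      have haC : a ∉ C := fun h => ha ((QuotientGroup.eq_one_iff a).2 h)
      rw [← QuotientGroup.mk_inv, hmem, hmem, inv_mem_iff]
      exact (LO.mem_or_inv_mem hP (g := a) (by rintro rfl; exact haC (one_mem C))).imp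
        (fun h => ⟨h, haC⟩) fun h => ⟨h, haC⟩
  have harch : ∀ f ∈ R, ∀ x, ∃ n : ℕ, x⁻¹ * f ^ n ∈ R := by
    intro f hf x
    induction f using QuotientGroup.induction_on with | _ f
    induction x using QuotientGroup.induction_on with | _ x
    rw [hmem] at hf
    obtain ⟨n, hn⟩ := hC.exists_inv_mul_pow_mem hP hk hinv hf.1 hf.2 x
    -- one further factor `f` moves the element out of `C`
    refine ⟨n + 1, ?_⟩
    rw [← QuotientGroup.mk_inv, ← QuotientGroup.mk_pow, ← QuotientGroup.mk_mul, hmem, pow_succ,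
      ← mul_assoc]
    refine ⟨LO.mul_mem hP hn hf.1, fun h => ?_⟩
    have h1 := hC.convex _ _ hn (by simpa [mul_assoc] using hf.1) h
    exact hf.2 ((Subgroup.mul_mem_cancel_left C h1).1 h)
  have := mul_comm_of_archimedean hRLO harch x y
  rw [← QuotientGroup.eq_one_iff]
  simp [this]

end IsMaxConvex

end MaxConvex

/-! ### Orders from affine actions on the real line -/

section Affine

variable {G : Type*} [Group G] {P : Set G}

/-- If `G` acts on the real line by `g • x = r g * x + τ g` with `0 < r g`, then each `x` gives a
left-ordering: the positive elements are those moving `x` to the right, and elements fixing `x` are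
compared by a given order. -/
theorem affine_mem_LO (hP : P ∈ LO G) (r τ : G → ℝ) (hr : ∀ g, 0 < r g)
    (hrmul : ∀ g h, r (g * h) = r g * r h) (hτ : ∀ g h, τ (g * h) = r g * τ h + τ g) (x : ℝ) :
    {g | x < r g * x + τ g ∨ (r g * x + τ g = x ∧ g ∈ P)} ∈ LO G := by
  have hmul : ∀ g h, r (g * h) * x + τ (g * h) = r g * (r h * x + τ h) + τ g := fun g h => by
    rw [hrmul, hτ]; ring
  have h1 : r 1 = 1 := by
    have := hrmul 1 1
    rw [mul_one] at this
    exact mul_left_cancel₀ (hr 1).ne' (by rw [← this, mul_one])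
  have hτ1 : τ 1 = 0 := by
    have := hτ 1 1
    rw [mul_one, h1] at this
    linarith
  have hinv : ∀ g, r g * (r g⁻¹ * x + τ g⁻¹) + τ g = x := fun g => by
    rw [← hmul, mul_inv_cancel, h1, hτ1]; ring
  refine mem_LO_iff.2 ⟨?_, ?_, ?_⟩
  · rintro g hg h hh
    simp only [Set.mem_ofPred_eq] at hg hh ⊢
    rw [hmul]
    rcases hh with hh | ⟨hh, hhP⟩
    · left
      have := mul_lt_mul_of_pos_left hh (hr g)
      rcases hg with hg | ⟨hg, -⟩ <;> linarith
    · rw [hh]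
      exact hg.imp id fun hg => ⟨hg.1, LO.mul_mem hP hg.2 hhP⟩
  · rintro g hg hg'
    simp only [Set.mem_ofPred_eq] at hg hg'
    have h2 := hinv g
    rcases hg' with hg' | ⟨hg', hgP'⟩
    · have := mul_lt_mul_of_pos_left hg' (hr g)
      rcases hg with hg | ⟨hg, -⟩ <;> linarith
    · rw [hg'] at h2
      rcases hg with hg | ⟨-, hgP⟩
      · linarith
      · exact LO.inv_notMem hP hgP hgP'
  · intro g hg
    simp only [Set.mem_ofPred_eq]
    have h2 := hinv g
    rcases lt_trichotomy x (r g * x + τ g) with h | h | h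
    · exact Or.inl (Or.inl h)
    · have h3 : r g⁻¹ * x + τ g⁻¹ = x :=
        mul_left_cancel₀ (hr g).ne' (by linarith)
      exact (LO.mem_or_inv_mem hP hg).imp (fun h' => Or.inr ⟨h.symm, h'⟩) fun h' => Or.inr ⟨h3, h'⟩
    · refine Or.inr (Or.inl ?_)
      by_contra! h3
      have := mul_le_mul_of_nonneg_left h3 (hr g).le
      linarith

theorem not_countable_of_injective_real {X : Type*} {S : Set X} {f : ℝ → X} (hf : ∀ t, f t ∈ S)
    (hinj : ∀ s t, s < t → f s ≠ f t) : ¬ S.Countable := by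
  intro h
  refine Cardinal.not_countable_real ?_
  refine Set.MapsTo.countable_of_injOn (f := f) (fun t _ => hf t) (fun s _ t _ hst => ?_) h
  by_contra hne
  rcases lt_or_gt_of_ne hne with h | h
  exacts [hinj s t h hst, hinj t s h hst.symm]

/-- The divisible group `ℝ` is injective, so homomorphisms to it extend. -/
theorem exists_hom_real_of_injective {N : Subgroup G} [N.Normal]
    (hcomm : ∀ x y : G, x * y * x⁻¹ * y⁻¹ ∈ N) {X : Type*} [AddCommGroup X]
    (i : X → G) (hi : ∀ x y, (i (x + y))⁻¹ * (i x * i y) ∈ N) (hker : ∀ x, i x ∈ N → x = 0)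
    (φ : X →+ ℝ) : ∃ f : G → ℝ, (∀ g h, f (g * h) = f g + f h) ∧ (∀ g ∈ N, f g = 0) ∧
      ∀ x, f (i x) = φ x := by
  let _ : CommGroup (G ⧸ N) :=
    { (inferInstance : Group (G ⧸ N)) with
      mul_comm := by
        intro a b
        induction a using QuotientGroup.induction_on with | _ a
        induction b using QuotientGroup.induction_on with | _ b
        rw [← QuotientGroup.mk_mul, ← QuotientGroup.mk_mul, eq_comm, QuotientGroup.eq]
        simpa [mul_assoc] using hcomm a⁻¹ b⁻¹ }
  let j : X →+ Additive (G ⧸ N) := AddMonoidHom.mk' (fun x => Additive.ofMul (i x : G ⧸ N))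
    fun x y => by
      rw [← ofMul_mul, ← QuotientGroup.mk_mul]
      exact congrArg Additive.ofMul (QuotientGroup.eq.2 (hi x y))
  have hj : Function.Injective j := by
    rw [injective_iff_map_eq_zero]
    intro x hx
    exact hker x ((QuotientGroup.eq_one_iff _).1 (Additive.ofMul.injective hx))
  obtain ⟨F, hF⟩ := (Module.Baer.of_divisible ℝ).extension_property_addMonoidHom j hj φ
  refine ⟨fun g => F (Additive.ofMul (g : G ⧸ N)), fun g h => ?_, fun g hg => ?_, fun x => ?_⟩
  · change F (Additive.ofMul ((g * h : G) : G ⧸ N)) = _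
    rw [QuotientGroup.mk_mul, ofMul_mul, map_add]
  · change F (Additive.ofMul (g : G ⧸ N)) = 0
    rw [(QuotientGroup.eq_one_iff g).2 hg, ofMul_one, map_zero]
  · exact DFunLike.congr_fun hF x

/-- Independent elements `a` and `b` of a commutative quotient give homomorphisms to `ℝ` with
`a ↦ 1` and `b ↦ t` for every real number `t`, and different `t` lead to different orders. -/
theorem not_countable_LO_of_independent (hP : P ∈ LO G) {N : Subgroup G} [N.Normal]
    (hcomm : ∀ x y : G, x * y * x⁻¹ * y⁻¹ ∈ N) (a b : G)
    (hind : ∀ m n : ℤ, a ^ m * b ^ n ∈ N → m = 0 ∧ n = 0) : ¬ (LO G).Countable := by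
  have hf : ∀ t : ℝ, ∃ f : G → ℝ, (∀ g h, f (g * h) = f g + f h) ∧
      ∀ m n : ℤ, f (a ^ m * b ^ n) = m + n * t := by
    intro t
    obtain ⟨f, h1, -, h2⟩ := exists_hom_real_of_injective hcomm (X := ℤ × ℤ)
      (fun x => a ^ x.1 * b ^ x.2) (fun x y => by
        have : (a ^ (x + y).1 * b ^ (x + y).2)⁻¹ * (a ^ x.1 * b ^ x.2 * (a ^ y.1 * b ^ y.2)) =
            (b ^ (x.2 + y.2))⁻¹ * ((a ^ y.1)⁻¹ * b ^ x.2 * (a ^ y.1)⁻¹⁻¹ * (b ^ x.2)⁻¹)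
              * (b ^ (x.2 + y.2))⁻¹⁻¹ := by
          simp only [Prod.fst_add, Prod.snd_add, zpow_add]
          group
        rw [this]
        exact Subgroup.Normal.conj_mem inferInstance _ (hcomm _ _) _)
      (fun x hx => Prod.ext (hind _ _ hx).1 (hind _ _ hx).2)
      ((Int.castAddHom ℝ).coprod ((zmultiplesHom ℝ) t))
    exact ⟨f, h1, fun m n => by simpa using h2 (m, n)⟩
  choose f hfmul hfab using hf
  refine not_countable_of_injective_real (fun t => affine_mem_LO hP (fun _ => 1) (f t)
    (fun _ => one_pos) (fun _ _ => (one_mul 1).symm)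
    (fun g h => by rw [hfmul, one_mul, add_comm]) 0) ?_
  intro s t hst heq
  obtain ⟨q, hsq, hqt⟩ := exists_rat_btwn hst
  have hden : (0 : ℝ) < q.den := by exact_mod_cast q.pos
  have hq : (q : ℝ) * q.den = q.num := by exact_mod_cast Rat.mul_den_eq_num q
  have := (Set.ext_iff.1 heq (a ^ (-q.num) * b ^ (q.den : ℤ))).2 (by
    left
    rw [hfab]
    push_cast
    nlinarith)
  have h2 := mul_lt_mul_of_pos_right hsq hden
  simp only [Set.mem_ofPred_eq, hfab] at this
  push_cast at this
  rcases this with h | ⟨h, -⟩ <;> linarith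

/-- Any two elements of `G` are linearly dependent modulo `C`; for torsion-free abelian `G ⧸ C`
this says that the rank is at most one. -/
def HasRankOneQuotient (C : Subgroup G) : Prop :=
  ∀ a ∉ C, ∀ b, ∃ n : ℕ, n ≠ 0 ∧ ∃ m : ℤ, a ^ m * b ^ n ∈ C

theorem IsMaxConvex.hasRankOneQuotient {C : Subgroup G} (hC : IsMaxConvex P C) (hP : P ∈ LO G)
    {k : ℕ} (hk : k ≠ 0) (hinv : IsPowInvariant k P) (hcount : (LO G).Countable) :
    HasRankOneQuotient C := by
  have := hC.normal hP hk hinv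
  intro a ha b
  by_contra! hne
  refine not_countable_LO_of_independent hP (hC.commutator_mem hP hk hinv) a b ?_ hcount
  have key : ∀ (m : ℤ) (n : ℕ), a ^ m * b ^ n ∈ C → m = 0 ∧ n = 0 := by
    intro m n h
    have hn : n = 0 := by
      by_contra hn
      exact hne n hn m h
    refine ⟨?_, hn⟩
    subst hn
    rw [pow_zero, mul_one] at h
    by_contra hm
    exact ha (hC.convex.of_zpow_mem hP hm h)
  intro m n h
  obtain ⟨n, rfl | rfl⟩ := n.eq_nat_or_neg
  · rw [zpow_natCast] at h
    simpa using key m n h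
  · have h1 : a ^ (-m) * b ^ n ∈ C := by
      have h2 := Subgroup.Normal.conj_mem this _ (inv_mem h) (b ^ (-(n : ℤ)))
      have h3 : b ^ (-(n : ℤ)) * (a ^ m * b ^ (-(n : ℤ)))⁻¹ * (b ^ (-(n : ℤ)))⁻¹ =
        a ^ (-m) * b ^ n := by simp
      rwa [h3] at h2
    simpa using key _ n h1

end Affine

/-! ### Two consecutive quotients of rank one -/

section RankOne

variable {G : Type*} [Group G] {P Q : Set G}

theorem map_zpow_of_map_mul {f : G → ℝ} (hf : ∀ g h, f (g * h) = f g + f h) (g : G) (m : ℤ) :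
    f (g ^ m) = m * f g := by
  let F : G →* Multiplicative ℝ := MonoidHom.mk' (fun g => Multiplicative.ofAdd (f g)) fun g h => by
    rw [hf, ofAdd_add]
  have := congrArg Multiplicative.toAdd (map_zpow F g m)
  simpa [F] using this

theorem IsConvexFor.neg_of_zpow_mul_pow_mem {N : Subgroup G} (hN : IsConvexFor P N) (hP : P ∈ LO G)
    {a b : G} (ha : a ∈ P) (haN : a ∉ N) (hb : b ∈ P) (hbN : b ∉ N) {m : ℤ} {n : ℕ} (hn : n ≠ 0)
    (h : a ^ m * b ^ n ∈ N) : m < 0 := by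
  by_contra! hm
  lift m to ℕ using hm
  rw [zpow_natCast] at h
  by_cases hm : m = 0
  · subst hm
    rw [pow_zero, one_mul] at h
    exact hbN (hN.of_pow_mem hP hn h)
  · have h1 := hN (a ^ m) _ (LO.pow_mem hP ha hm) (by simpa using LO.pow_mem hP hb hn) h
    exact haN (hN.of_pow_mem hP hm h1)

/-- A torsion-free group of rank one carries only two orders: two orders for which `N` is convex and
which agree at one element outside `N` agree at all elements outside `N`. -/
theorem HasRankOneQuotient.mem_of_mem {N : Subgroup G} (hrk : HasRankOneQuotient N)
    (hP : P ∈ LO G) (hQ : Q ∈ LO G) (hNP : IsConvexFor P N) (hNQ : IsConvexFor Q N) {a b : G}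
    (haN : a ∉ N) (haP : a ∈ P) (haQ : a ∈ Q) (hbN : b ∉ N) (hbP : b ∈ P) : b ∈ Q := by
  obtain ⟨n, hn, m, h⟩ := hrk a haN b
  have hm := hNP.neg_of_zpow_mul_pow_mem hP haP haN hbP hbN hn h
  obtain ⟨l, rfl⟩ : ∃ l : ℕ, m = -l := ⟨m.natAbs, by lia⟩
  have hl : l ≠ 0 := by lia
  by_contra hbQ
  have hb := LO.inv_mem_of_notMem hQ (LO.ne_one hP hbP) hbQ
  have h1 : (b⁻¹) ^ n * a ^ l ∈ N := by simpa using inv_mem h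
  have h2 := hNQ _ _ (LO.pow_mem hQ hb hn) (by simpa using LO.pow_mem hQ haQ hl) h1
  exact hbN (inv_mem_iff.1 (hNQ.of_pow_mem hQ hn h2))

/-- If `C` and `N` are consecutive terms of a series whose quotients `G ⧸ C` and `C ⧸ N` have rank
one, and if `G` preserves the order of `C ⧸ N` under conjugation, then there are uncountably many
orders. Conjugation acts on `C ⧸ N ⊆ ℝ` by a scaling character `r`. If `r` is nontrivial, commutators
with an element `t` with `r t ≠ 1` extend the translations by `C ⧸ N` to an affine action of `G` on
the real line; if it is trivial, `G ⧸ N` is abelian of rank two. -/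
theorem exists_conj_inv_mem (hP : P ∈ LO G) (hcount : (LO G).Countable) {C : Subgroup G} [C.Normal]
    (hC : IsConvexFor P C) (hcomm : ∀ x y : G, x * y * x⁻¹ * y⁻¹ ∈ C)
    (hrk : HasRankOneQuotient C) (hCtop : C ≠ ⊤) {N : Subgroup C} [N.Normal]
    (hN : IsConvexFor (C.subtype ⁻¹' P) N) (hNcomm : ∀ x y : C, x * y * x⁻¹ * y⁻¹ ∈ N)
    (hNrk : HasRankOneQuotient N) (hNtop : N ≠ ⊤)
    (hNinv : ∀ (g : G), ∀ c ∈ N, MulAut.conjNormal g c ∈ N) :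
    ∃ g : G, ∃ a : C, a ∉ N ∧ (a : G) ∈ P ∧ (g * a * g⁻¹)⁻¹ ∈ P := by
  by_contra! hneg
  have hPC : C.subtype ⁻¹' P ∈ LO C := LO.preimage_mem hP C.subtype_injective
  have hNinv' : ∀ (g : G) (c : C), c ∉ N → MulAut.conjNormal g c ∉ N := fun g c hc h => hc <| by
    simpa using hNinv g⁻¹ _ h
  have hpos : ∀ (g : G) (c : C), c ∉ N → (c : G) ∈ P → (MulAut.conjNormal g c : C).1 ∈ P := by
    intro g c hcN hcP
    by_contra h
    refine hneg g c hcN hcP (LO.inv_mem_of_notMem hP ?_ (by simpa using h))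
    simpa using LO.ne_one hP hcP
  obtain ⟨a₀, ha₀N, ha₀P⟩ : ∃ a : C, a ∉ N ∧ (a : G) ∈ P := by
    obtain ⟨a, ha⟩ := SetLike.exists_not_mem_of_ne_top N hNtop rfl
    rcases LO.mem_or_inv_mem hPC (g := a) (by rintro rfl; exact ha (one_mem N)) with h | h
    · exact ⟨a, ha, h⟩
    · exact ⟨a⁻¹, fun h' => ha (inv_mem_iff.1 h'), h⟩
  obtain ⟨ι, hιmul, hιN, hι₀⟩ := exists_hom_real_of_injective hNcomm (X := ℤ) (fun m => a₀ ^ m)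
    (fun x y => by simp [zpow_add])
    (fun m hm => by_contra fun h => ha₀N (hN.of_zpow_mem hPC h hm)) (Int.castAddHom ℝ)
  replace hι₀ : ι a₀ = 1 := by simpa using hι₀ 1
  have hιpow := map_zpow_of_map_mul hιmul
  have hι1 : ι 1 = 0 := hιN 1 (one_mem N)
  have hιinv : ∀ c, ι c⁻¹ = -ι c := fun c => by simpa using hιpow c (-1)
  have hιpos : ∀ c : C, c ∉ N → (c : G) ∈ P → 0 < ι c := by
    intro c hcN hcP
    obtain ⟨n, hn, m, h⟩ := hNrk a₀ ha₀N c
    have hm := hN.neg_of_zpow_mul_pow_mem hPC ha₀P ha₀N hcP hcN hn h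
    have h1 := hιN _ h
    rw [← zpow_natCast, hιmul, hιpow, hιpow, hι₀, mul_one] at h1
    have hm' : (m : ℝ) < 0 := by exact_mod_cast hm
    have h2 : 0 < (n : ℝ) * ι c := by push_cast at h1; linarith
    exact pos_of_mul_pos_right h2 (Nat.cast_nonneg n)
  have hιker : ∀ c : C, ι c = 0 → c ∈ N := by
    intro c hc
    by_contra hcN
    rcases LO.mem_or_inv_mem hPC (g := c) (by rintro rfl; exact hcN (one_mem N)) with h | h
    · exact (hιpos c hcN h).ne' hc
    · exact (hιpos c⁻¹ (fun h' => hcN (inv_mem_iff.1 h')) h).ne' (by rw [hιinv, hc, neg_zero])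
  set r : G → ℝ := fun g => ι (MulAut.conjNormal g a₀) with hr
  have hscale : ∀ (g : G) (c : C), ι (MulAut.conjNormal g c) = r g * ι c := by
    intro g c
    obtain ⟨n, hn, m, h⟩ := hNrk a₀ ha₀N c
    have h1 := hιN _ h
    have h2 := hιN _ (hNinv g _ h)
    rw [← zpow_natCast] at h1 h2
    rw [hιmul, hιpow, hιpow, hι₀] at h1
    rw [map_mul, map_zpow, map_zpow, hιmul, hιpow, hιpow] at h2
    push_cast at h1 h2
    have hn' : (n : ℝ) ≠ 0 := by exact_mod_cast hn
    refine mul_left_cancel₀ hn' ?_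
    simp only [hr]
    linear_combination h2 - ι (MulAut.conjNormal g a₀) * h1
  have hrmul : ∀ g h, r (g * h) = r g * r h := fun g h => by
    rw [← hscale, hr]
    simp
  have hrpos : ∀ g, 0 < r g := fun g => hιpos _ (hNinv' g _ ha₀N) (hpos g _ ha₀N ha₀P)
  have hr1 : r 1 = 1 := by simp [hr, hι₀]
  have hrC : ∀ c : C, r c = 1 := fun c => by
    have : (MulAut.conjNormal (c : G) a₀ : C) = c * a₀ * c⁻¹ := Subtype.ext (by simp)
    simp only [hr, this, hιmul, hιinv, hι₀]
    ring
  -- `ω x t` is the translation part of the commutator of `x` and `t`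
  set ω : G → G → ℝ := fun x t => ι ⟨x * t * x⁻¹ * t⁻¹, hcomm x t⟩ with hω
  have hωmul : ∀ x y t, ω (x * y) t = r x * ω y t + ω x t := by
    intro x y t
    rw [← hscale, ← hιmul]
    refine congrArg ι (Subtype.ext ?_)
    simp [mul_assoc]
  have hωC : ∀ (c : C) t, ω c t = (1 - r t) * ι c := by
    intro c t
    have : ω c t = ι (c * (MulAut.conjNormal t c)⁻¹) := by
      refine congrArg ι (Subtype.ext ?_)
      simp [mul_assoc]
    rw [this, hιmul, hιinv, hscale]
    ring
  have hωself : ∀ t, ω t t = 0 := fun t => by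
    rw [← hι1]
    refine congrArg ι (Subtype.ext ?_)
    simp
  have hωswap : ∀ x t, ω t x = -ω x t := fun x t => by
    rw [← hιinv]
    refine congrArg ι (Subtype.ext ?_)
    simp [mul_assoc]
  by_cases hex : ∃ t, r t ≠ 1
  · obtain ⟨t, ht⟩ : ∃ t, r t < 1 := by
      obtain ⟨t, ht⟩ := hex
      rcases lt_or_gt_of_ne ht with h | h
      · exact ⟨t, h⟩
      · refine ⟨t⁻¹, ?_⟩
        have h1 := hrmul t⁻¹ t
        rw [inv_mul_cancel, hr1] at h1
        nlinarith [hrpos t⁻¹]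
    have ht' : 0 < 1 - r t := by linarith
    have hrpow : ∀ n : ℕ, r (t ^ n) = r t ^ n := by
      intro n
      induction n with
      | zero => simpa using hr1
      | succ n ih => rw [pow_succ, pow_succ, hrmul, ih]
    set τ : G → ℝ := fun g => ω g t / (1 - r t) with hτ
    have hτmul : ∀ g h, τ (g * h) = r g * τ h + τ g := fun g h => by
      simp only [hτ, hωmul]
      ring
    have hτC : ∀ c : C, τ c = ι c := fun c => by
      simp only [hτ, hωC]
      field_simp
    have hdense : Dense (Set.range ι) := by
      let S : AddSubgroup ℝ :=
        { carrier := Set.range ι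
          zero_mem' := ⟨1, hι1⟩
          add_mem' := by
            rintro _ _ ⟨a, rfl⟩ ⟨b, rfl⟩
            exact ⟨a * b, hιmul a b⟩
          neg_mem' := by
            rintro _ ⟨a, rfl⟩
            exact ⟨a⁻¹, hιinv a⟩ }
      refine S.dense_of_not_isolated_zero fun ε hε => ?_
      obtain ⟨n, hn⟩ := exists_pow_lt_of_lt_one hε ht
      exact ⟨r (t ^ n), ⟨_, rfl⟩, hrpos _, by rwa [hrpow]⟩
    refine not_countable_of_injective_real (affine_mem_LO hP r τ hrpos hrmul hτmul) ?_ hcount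
    intro x y hxy heq
    obtain ⟨_, ⟨c, rfl⟩, hxc, hcy⟩ := hdense.exists_between hxy
    -- the conjugate `c * t * c⁻¹` is a contraction with fixed point `ι c`
    have h1 : r (c * t * (c⁻¹ : C)) = r t := by rw [hrmul, hrmul, hrC, hrC]; ring
    have h2 : τ (c * t * (c⁻¹ : C)) = (1 - r t) * ι c := by
      have : τ t = 0 := by simp [hτ, hωself]
      rw [hτmul, hτmul, hrmul, hrC, hτC, hτC, hιinv, this]
      ring
    have h3 := (Set.ext_iff.1 heq (c * t * (c⁻¹ : C))).1 (Or.inl (by rw [h1, h2]; nlinarith))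
    simp only [Set.mem_ofPred_eq, h1, h2] at h3
    rcases h3 with h3 | ⟨h3, -⟩ <;> nlinarith
  · push Not at hex
    have hω0 : ∀ x t, ω x t = 0 := by
      intro x t
      have hadd : ∀ g h, ω (g * h) t = ω g t + ω h t := fun g h => by
        rw [hωmul, hex]; ring
      have hωC0 : ∀ c : C, ∀ s, ω c s = 0 := fun c s => by rw [hωC, hex]; ring
      by_cases htC : t ∈ C
      · rw [hωswap t x, hωC0 ⟨t, htC⟩, neg_zero]
      · obtain ⟨n, hn, m, h⟩ := hrk t htC x
        have h1 := hωC0 ⟨_, h⟩ t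
        have hpow := map_zpow_of_map_mul (f := fun g => ω g t) hadd
        rw [hadd, ← zpow_natCast, hpow, hpow, hωself] at h1
        have hn' : (n : ℝ) ≠ 0 := by exact_mod_cast hn
        simpa [hn'] using h1
    have hN' : (N.map C.subtype).Normal := by
      refine ⟨?_⟩
      rintro _ ⟨c, hc, rfl⟩ g
      exact ⟨MulAut.conjNormal g c, hNinv g c hc, by simp⟩
    obtain ⟨g₀, hg₀⟩ := SetLike.exists_not_mem_of_ne_top C hCtop rfl
    refine not_countable_LO_of_independent hP (N := N.map C.subtype)
      (fun x y => ⟨_, hιker _ (hω0 x y), rfl⟩) a₀ g₀ ?_ hcount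
    rintro m n ⟨c, hc, hceq⟩
    have hn : n = 0 := by
      by_contra hn
      refine hg₀ (hC.of_zpow_mem hP hn ?_)
      have h1 : (a₀ : G) ^ m * g₀ ^ n ∈ C := by rw [← hceq]; exact c.2
      exact (Subgroup.mul_mem_cancel_left C (zpow_mem a₀.2 m)).1 h1
    refine ⟨by_contra fun hm => ha₀N (hN.of_zpow_mem hPC hm ?_), hn⟩
    have : a₀ ^ m = c := by
      ext
      subst hn
      simpa using hceq.symm
    rwa [this]

end RankOne

/-! ### Rigidity of the convex series -/

section Rigidity

variable {G : Type*} [Group G] {P Q : Set G} {C : Subgroup G}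

/-- If conjugation by some `g` reverses the order of the rank one quotient `C ⧸ N`, then `C` is
convex for every order. For `d ∈ C` positive outside `N`, the conjugate `g⁻¹ * d * g` is negative, so
`d⁻¹ * g = g * (g⁻¹ * d * g)⁻¹` is positive as soon as `g` is; hence `g` lies above `C`. -/
theorem isConvexFor_of_conj_inv_mem (hP : P ∈ LO G) (hQ : Q ∈ LO G) [C.Normal]
    (hC : IsConvexFor P C) (hrk : HasRankOneQuotient C) {N : Subgroup C}
    (hN : ∀ R ∈ LO C, IsConvexFor R N) (hNrk : HasRankOneQuotient N)
    (hNinv : ∀ (g : G), ∀ c ∈ N, MulAut.conjNormal g c ∈ N) {g : G} {a : C} (haN : a ∉ N)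
    (haP : (a : G) ∈ P) (hga : (g * a * g⁻¹)⁻¹ ∈ P) : IsConvexFor Q C := by
  have hNinv' : ∀ (g : G) (c : C), c ∉ N → MulAut.conjNormal g c ∉ N := fun g c hc h => hc <| by
    simpa using hNinv g⁻¹ _ h
  have hPC : C.subtype ⁻¹' P ∈ LO C := LO.preimage_mem hP C.subtype_injective
  have hQC : C.subtype ⁻¹' Q ∈ LO C := LO.preimage_mem hQ C.subtype_injective
  have hrevP : ∀ d : C, d ∉ N → (d : G) ∈ P → (MulAut.conjNormal g d : C)⁻¹.1 ∈ P := by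
    have hR : (MulAut.conjNormal g : C ≃* C).toMonoidHom ⁻¹' (C.subtype ⁻¹' P)⁻¹ ∈ LO C :=
      LO.preimage_mem (LO.inv_mem hPC) (MulAut.conjNormal g : C ≃* C).injective
    intro d hdN hdP
    exact hNrk.mem_of_mem hPC hR (hN _ hPC) (hN _ hR) haN haP
      (by simpa using hga) hdN hdP
  have hrev : ∀ d : C, d ∉ N → (d : G) ∈ Q → (MulAut.conjNormal g d : C)⁻¹.1 ∈ Q := by
    intro d hdN hdQ
    have hgd : (MulAut.conjNormal g d : C)⁻¹ ∉ N := fun h => hNinv' g d hdN (inv_mem_iff.1 h)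
    rcases LO.mem_or_inv_mem hPC (g := d) (by rintro rfl; exact hdN (one_mem N)) with hd | hd
    · exact hNrk.mem_of_mem hPC hQC (hN _ hPC) (hN _ hQC) hdN hd hdQ hgd (hrevP d hdN hd)
    · have h1 := hrevP d⁻¹ (fun h => hdN (inv_mem_iff.1 h)) hd
      rw [map_inv, inv_inv] at h1
      have hPi := LO.inv_mem hPC
      refine hNrk.mem_of_mem hPi hQC (hN _ hPi) (hN _ hQC) hdN hd hdQ hgd ?_
      rw [Set.mem_inv, inv_inv]
      exact h1
  have hrev' : ∀ d : C, d ∉ N → (d : G) ∈ Q → (MulAut.conjNormal g⁻¹ d : C)⁻¹.1 ∈ Q := by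
    intro d hdN hdQ
    have h1 := hNinv' g⁻¹ d hdN
    by_contra h
    rcases LO.mem_or_inv_mem hQC (g := (MulAut.conjNormal g⁻¹ d : C))
      (by intro h'; exact h1 (h' ▸ one_mem N)) with h2 | h2
    · have h3 := hrev _ h1 h2
      refine LO.inv_notMem hQ hdQ ?_
      simpa using h3
    · exact h h2
  -- one of `g` and `g⁻¹` is positive, and both reverse the order of `C ⧸ N`
  obtain ⟨u, huQ, hu⟩ : ∃ u ∈ Q, ∀ d : C, d ∉ N → (d : G) ∈ Q →
      (MulAut.conjNormal u⁻¹ d : C)⁻¹.1 ∈ Q := by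
    rcases LO.mem_or_inv_mem hQ (g := g) (by
      rintro rfl
      exact LO.inv_notMem hP haP (by simpa using hga)) with h | h
    · exact ⟨g, h, hrev'⟩
    · exact ⟨g⁻¹, h, by rwa [inv_inv]⟩
  have above : ∀ c ∈ C, c⁻¹ * u ∈ Q := by
    have h1 : ∀ d : C, d ∉ N → (d : G) ∈ Q → (d : G)⁻¹ * u ∈ Q := by
      intro d hdN hdQ
      simpa [mul_assoc] using LO.mul_mem hQ huQ (hu d hdN hdQ)
    have h2 : ∀ c : C, c ∉ N → (c : G)⁻¹ * u ∈ Q := by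
      intro c hcN
      rcases LO.mem_or_inv_mem hQC (g := c) (by rintro rfl; exact hcN (one_mem N)) with h | h
      · exact h1 c hcN h
      · exact LO.mul_mem hQ h huQ
    obtain ⟨d, hdN, hdQ⟩ : ∃ d : C, d ∉ N ∧ (d : G) ∈ Q := by
      rcases LO.mem_or_inv_mem hQC (g := a) (by rintro rfl; exact haN (one_mem N)) with h | h
      exacts [⟨a, haN, h⟩, ⟨a⁻¹, fun h' => haN (inv_mem_iff.1 h'), h⟩]
    intro c hc
    by_cases hcN : (⟨c, hc⟩ : C) ∈ N
    · have h3 := (hN _ hQC).mul_left_mem hQC hdQ hdN (inv_mem hcN)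
      simpa [mul_assoc] using LO.mul_mem hQ (show c⁻¹ * (d : G) ∈ Q from h3) (h1 d hdN hdQ)
    · exact h2 ⟨c, hc⟩ hcN
  have huC : u ∉ C := fun h => LO.one_notMem hQ (by simpa using above u h)
  have abovePow : ∀ n : ℕ, n ≠ 0 → ∀ c ∈ C, c⁻¹ * u ^ n ∈ Q := by
    intro n hn c hc
    obtain ⟨j, rfl⟩ := Nat.exists_eq_succ_of_ne_zero hn
    rw [Nat.succ_eq_add_one, pow_succ', ← mul_assoc]
    by_cases hj : j = 0
    · subst hj; simpa using above c hc
    · exact LO.mul_mem hQ (above c hc) (LO.pow_mem hQ huQ hj)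
  have aboveAll : ∀ x ∈ Q, x ∉ C → ∀ c ∈ C, c⁻¹ * x ∈ Q := by
    intro x hxQ hxC c hc
    by_contra hneg
    have h1 : c⁻¹ * x ≠ 1 := fun h => hxC (by rwa [← inv_mul_eq_one.1 h])
    have h2 : x⁻¹ * c ∈ Q := by simpa using LO.inv_mem_of_notMem hQ h1 hneg
    -- if `x` were bounded by an element of `C`, so would be all its powers
    have hbdd : ∀ n : ℕ, ∃ d ∈ C, (x ^ n)⁻¹ * d ∈ Q := by
      intro n
      induction n with
      | zero => exact ⟨c, hc, by simpa using LO.mul_mem hQ hxQ h2⟩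
      | succ n ih =>
        obtain ⟨d, hd, hd'⟩ := ih
        refine ⟨x * d * x⁻¹ * c, mul_mem (Subgroup.Normal.conj_mem inferInstance d hd x) hc, ?_⟩
        have : (x ^ (n + 1))⁻¹ * (x * d * x⁻¹ * c) = (x ^ n)⁻¹ * d * (x⁻¹ * c) := by
          rw [pow_succ']; group
        rw [this]
        exact LO.mul_mem hQ hd' h2
    obtain ⟨n, hn, m, h⟩ := hrk u huC x
    obtain ⟨l, rfl | rfl⟩ := m.eq_nat_or_neg
    · rw [zpow_natCast] at h
      by_cases hl : l = 0
      · subst hl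
        exact hxC (hC.of_pow_mem hP hn (by simpa using h))
      · have h3 := abovePow l hl _ h
        rw [mul_inv_rev, mul_assoc, inv_mul_cancel, mul_one] at h3
        exact LO.inv_notMem hQ (LO.pow_mem hQ hxQ hn) h3
    · obtain ⟨d, hd, hd'⟩ := hbdd n
      rw [zpow_neg, zpow_natCast] at h
      by_cases hl : l = 0
      · subst hl
        exact hxC (hC.of_pow_mem hP hn (by simpa using h))
      · -- `x ^ n = e * u ^ l` with `e ∈ C` lies above `d`
        have he : x ^ n * (u ^ l)⁻¹ ∈ C := by
          have := Subgroup.Normal.conj_mem inferInstance _ h (u ^ l)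
          simpa [mul_assoc] using this
        have h3 := abovePow l hl _ (mul_mem (inv_mem he) hd)
        have h4 : d⁻¹ * x ^ n ∈ Q := by simpa [mul_assoc] using h3
        exact LO.inv_notMem hQ hd' (by simpa using h4)
  intro x y hx hxy hy
  by_contra hxC
  exact LO.inv_notMem hQ hxy (by simpa using aboveAll x hx hxC y hy)

/-- When `C` is convex for all orders and `G ⧸ C` has rank one, an order of `G` is determined by its
restriction to `C` and the sign of a single element outside `C`. -/
theorem finite_LO_of_isConvexFor (hC : ∀ Q ∈ LO G, IsConvexFor Q C) (hrk : HasRankOneQuotient C)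
    (hCtop : C ≠ ⊤) (hfin : (LO C).Finite) : (LO G).Finite := by
  obtain ⟨g, hg⟩ := SetLike.exists_not_mem_of_ne_top C hCtop rfl
  refine Set.Finite.of_injOn (f := fun Q : Set G => (C.subtype ⁻¹' Q, g ∈ Q))
    (t := LO C ×ˢ Set.univ) (fun Q hQ => ⟨LO.preimage_mem hQ C.subtype_injective, trivial⟩) ?_
    (hfin.prod Set.finite_univ)
  intro Q hQ R hR h
  obtain ⟨h1, h2⟩ := Prod.ext_iff.1 h
  refine LO.eq_of_subset hQ hR fun b hb => ?_
  by_cases hbC : b ∈ C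
  · exact (Set.ext_iff.1 h1 ⟨b, hbC⟩).1 hb
  · have hg1 : g ≠ 1 := by rintro rfl; exact hg (one_mem C)
    by_cases hgQ : g ∈ Q
    · exact hrk.mem_of_mem hQ hR (hC Q hQ) (hC R hR) hg hgQ (h2.mp hgQ) hbC hb
    · have hgR : g ∉ R := fun h => hgQ (h2.mpr h)
      exact hrk.mem_of_mem hQ hR (hC Q hQ) (hC R hR) (fun h => hg (inv_mem_iff.1 h))
        (LO.inv_mem_of_notMem hQ hg1 hgQ) (LO.inv_mem_of_notMem hR hg1 hgR) hbC hb

theorem isConvexFor_iff_subgroupOf (hQ : Q ∈ LO G) (hC : IsConvexFor Q C)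
    (hrk : HasRankOneQuotient C) (K : Subgroup G) :
    IsConvexFor Q K ↔ K = ⊤ ∨ (K ≤ C ∧ IsConvexFor (C.subtype ⁻¹' Q) (K.subgroupOf C)) := by
  constructor
  · intro hK
    by_cases hKC : K ≤ C
    · exact Or.inr ⟨hKC, fun x y hx hxy hy => hK x y hx hxy hy⟩
    · left
      have hCK := (hK.le_total hC hQ).resolve_left hKC
      obtain ⟨x, hxK, hxC⟩ := SetLike.not_le_iff_exists.1 hKC
      refine (Subgroup.eq_top_iff' K).2 fun y => ?_
      obtain ⟨n, hn, m, h⟩ := hrk x hxC y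
      exact hK.of_pow_mem hQ hn ((Subgroup.mul_mem_cancel_left K (zpow_mem hxK m)).1 (hCK h))
  · rintro (rfl | ⟨hKC, hK⟩)
    · exact isConvexFor_top
    · intro x y hx hxy hy
      have hxC := hC x y hx hxy (hKC hy)
      exact hK ⟨x, hxC⟩ ⟨y, hKC hy⟩ hx hxy hy

end Rigidity

/-! ### Induction on the number of convex subgroups -/

theorem IsConvexFor.comap {G H : Type*} [Group G] [Group H] {P : Set G} {K : Subgroup G}
    (hK : IsConvexFor P K) (e : H →* G) : IsConvexFor (e ⁻¹' P) (K.comap e) := by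
  intro x y hx hxy hy
  exact hK (e x) (e y) hx (by simpa using hxy) hy

/-- That all orders have the same convex subgroups is what makes the induction work: it shows that
the convex subgroups of `C` are normal in `G`. -/
theorem finite_LO_and_isConvexFor_iff (n : ℕ) : ∀ (G : Type*) [Group G] (P : Set G) (k : ℕ),
    P ∈ LO G → k ≠ 0 → IsPowInvariant k P → (LO G).Countable →
    {C : Subgroup G | IsConvexFor P C}.ncard = n →
    (LO G).Finite ∧ ∀ Q ∈ LO G, ∀ K, IsConvexFor Q K ↔ IsConvexFor P K := by
  induction n using Nat.strong_induction_on with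
  | _ n ih =>
  intro G _ P k hP hk hinv hcount hn
  rcases subsingleton_or_nontrivial G with hG | hG
  · refine ⟨Set.toFinite _, fun Q hQ K => iff_of_true ?_ ?_⟩ <;>
    · intro x y _ _ _
      rw [Subsingleton.elim x 1]
      exact one_mem K
  have hconv := finite_isConvexFor_of_countable hP hcount
  obtain ⟨C, hC⟩ := exists_isMaxConvex hP hconv
  have hCn : C.Normal := hC.normal hP hk hinv
  have hCcomm := hC.commutator_mem hP hk hinv
  have hCrk := hC.hasRankOneQuotient hP hk hinv hcount
  have hPC : C.subtype ⁻¹' P ∈ LO C := LO.preimage_mem hP C.subtype_injective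
  have hCinv : IsPowInvariant k (C.subtype ⁻¹' P) := fun g x hx => by
    simpa using hinv (g : G) (x : G) hx
  have hCcount := countable_LO_of_isConvexFor hP hC.convex hcount
  have hlt : {K : Subgroup C | IsConvexFor (C.subtype ⁻¹' P) K}.ncard < n := by
    rw [← hn, ← Set.ncard_image_of_injective _ (Subgroup.map_injective C.subtype_injective)]
    refine Set.ncard_lt_ncard ⟨?_, fun h => ?_⟩ hconv
    · rintro _ ⟨K, hK, rfl⟩
      refine (isConvexFor_iff_subgroupOf hP hC.convex hCrk _).2
        (Or.inr ⟨Subgroup.map_subtype_le K, ?_⟩)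
      rwa [Subgroup.subgroupOf, Subgroup.comap_map_eq_self_of_injective C.subtype_injective]
    · obtain ⟨K, -, hK⟩ := h (isConvexFor_top : IsConvexFor P ⊤)
      exact hC.ne_top (top_le_iff.1 (hK ▸ Subgroup.map_subtype_le K))
  obtain ⟨hCfin, hCiff⟩ := ih _ hlt C (C.subtype ⁻¹' P) k hPC hk hCinv hCcount rfl
  have hCall : ∀ Q ∈ LO G, IsConvexFor Q C := by
    intro Q hQ
    rcases subsingleton_or_nontrivial C with hCs | hCs
    · rw [C.eq_bot_of_subsingleton]
      exact isConvexFor_bot hQ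
    obtain ⟨N, hN⟩ := exists_isMaxConvex hPC (finite_isConvexFor_of_countable hPC hCcount)
    have hNn : N.Normal := hN.normal hPC hk hCinv
    have hNinv : ∀ (g : G), ∀ c ∈ N, MulAut.conjNormal g c ∈ N := by
      have h1 : ∀ (g : G) (c : C), MulAut.conjNormal g c ∈ N → c ∈ N := by
        intro g
        set e : C →* C := (MulAut.conjNormal g : C ≃* C).toMonoidHom
        have h2 := LO.preimage_mem hPC (f := e) (MulAut.conjNormal g : C ≃* C).injective
        have h3 := (hCiff _ h2 _).1 (hN.convex.comap e)
        refine hN.le_of_ne_top _ h3 fun htop => hN.ne_top ((Subgroup.eq_top_iff' N).2 fun c => ?_)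
        have h4 : (MulAut.conjNormal g : C ≃* C).symm c ∈ N.comap e := htop ▸ Subgroup.mem_top _
        simpa [e] using h4
      intro g c hc
      exact h1 g⁻¹ _ (by simpa using hc)
    have hNrk := hN.hasRankOneQuotient hPC hk hCinv hCcount
    obtain ⟨g, a, haN, haP, hga⟩ := exists_conj_inv_mem hP hcount hC.convex hCcomm hCrk hC.ne_top
      hN.convex (hN.commutator_mem hPC hk hCinv) hNrk hN.ne_top hNinv
    exact isConvexFor_of_conj_inv_mem hP hQ hC.convex hCrk
      (fun R hR => (hCiff R hR N).2 hN.convex) hNrk hNinv haN haP hga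
  refine ⟨finite_LO_of_isConvexFor hCall hCrk hC.ne_top hCfin, fun Q hQ K => ?_⟩
  rw [isConvexFor_iff_subgroupOf hQ (hCall Q hQ) hCrk,
    isConvexFor_iff_subgroupOf hP hC.convex hCrk,
    hCiff _ (LO.preimage_mem hQ C.subtype_injective)]

theorem mainTheorem10 {G : Type*} [Group G] (hG : IsLeftOrderable G) :
    (LO G).Finite ∨ ¬ (LO G).Countable := by
  by_cases hcount : (LO G).Countable
  · left
    rcases (LO G).eq_empty_or_nonempty with hne | hne
    · rw [hne]
      exact Set.finite_empty
    · obtain ⟨P, hP, k, hk, hinv⟩ := exists_isPowInvariant hne hcount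
      exact (finite_LO_and_isConvexFor_iff _ G P k hP hk hinv hcount rfl).1
  · exact Or.inr hcount
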